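/- Let $p$ be a prime. All rings below are commutative Noetherian local rings of characteristic $p$. For such a ring $(A,\mathfrak a)$ of Krull dimension $d$, write $F^e$ for the $e$-th iterate of the Frobenius endomorphism of $A$ and also for the $p^e$-linear map $F^e\colon H^i_{\mathfrak a}(A)\to H^i_{\mathfrak a}(A)$ that it induces on local cohomology; in terms of the Čech complex on a system of parameters of $A$, it sends the class of a cocycle $(a_s)_s$ to the class of $(a_s^{p^e})_s$. Put $$0^F_{H^i_{\mathfrak a}(A)}=\{\eta\in H^i_{\mathfrak a}(A) : F^e(\eta)=0 \text{ for all } e\gg 0\}.$$ For an $A$-module $M$, let $0^*_M$ (the tight closure of zero in $M$) be the set of $\eta\in M$ for which there is an element $c\in A$ lying in no minimal prime of $A$ such that $\eta\otimes F^e_*c=0$ in $M\otimes_A F^e_*A$ for all $e\gg 0$, where $F^e_*A$ is $A$ regarded as an $A$-module via $F^e$ and $F^e_*c$ is $c$ regarded as an element of it. The ring $A$ is *weakly $F$-nilpotent* if $0^F_{H^i_{\mathfrak a}(A)}=H^i_{\mathfrak a}(A)$ for all $0\le i<d$; it is *$F$-nilpotent* if it is weakly $F$-nilpotent and $0^*_{H^d_{\mathfrak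 a}(A)}=0^F_{H^d_{\mathfrak a}(A)}$. **Theorem.** Let $\varphi\colon (R,\mathfrak m)\to(S,\mathfrak n)$ be a purely inseparable local homomorphism of Noetherian local rings of characteristic $p$; that is, $\varphi$ is a local homomorphism, for every $s\in S$ there is $e\in\mathbb N$ with $s^{p^e}\in\varphi(R)$, and every element of $\ker\varphi$ is nilpotent (given the condition on powers, the last condition says that $\operatorname{Spec}S\to\operatorname{Spec}R$ is a bijection). 1. If $R$ is weakly $F$-nilpotent, then $S$ is weakly $F$-nilpotent. 2. If $\varphi$ is faithfully flat and $R$ is $F$-nilpotent, then $S$ is $F$-nilpotent. -/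

import Mathlib

open scoped TensorProduct

noncomputable section

namespace FNil

section Cech

variable {R : Type*} [CommRing R] {n : ℕ} (x : Fin n → R)

/-- The restriction map `R_{x_s} → R_{x_t}` for `s ⊆ t`, where `x_s = ∏_{k ∈ s} x_k`. -/
def cechRes {s t : Finset (Fin n)} (h : s ⊆ t) :
    Localization.Away (∏ k ∈ s, x k) →ₐ[R] Localization.Away (∏ k ∈ t, x k) :=
  IsLocalization.liftAlgHom (M := Submonoid.powers (∏ k ∈ s, x k))
    (f := Algebra.ofId R (Localization.Away (∏ k ∈ t, x k))) (by
      rintro ⟨_, m, rfl⟩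
      refine (?_ : IsUnit (algebraMap R (Localization.Away (∏ k ∈ t, x k)) _))
      rw [map_pow]
      exact (isUnit_of_dvd_unit (map_dvd _ (Finset.prod_dvd_prod_of_subset s t x h))
        (IsLocalization.Away.algebraMap_isUnit (∏ k ∈ t, x k))).pow m)

/-- The `i`-th term `∏_{|s| = i} R_{x_s}` of the Čech complex of `R` on `x_1, …, x_n`. -/
abbrev CechCochain (i : ℕ) : Type _ :=
  ∀ s : {s : Finset (Fin n) // s.card = i}, Localization.Away (∏ k ∈ s.1, x k)

/-- The Čech differential: `(δ a)_t = ∑_{j ∈ t} (-1)^{#{k ∈ t : k < j}} a_{t ∖ {j}}|_{R_{x_t}}`. -/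
def cechD (i : ℕ) : CechCochain x i →ₗ[R] CechCochain x (i + 1) :=
  LinearMap.pi fun t => ∑ j : {j // j ∈ t.1},
    ((-1 : R) ^ (t.1.filter (fun k => k < j.1)).card) •
      ((cechRes x (Finset.erase_subset j.1 t.1)).toLinearMap ∘ₗ
        LinearMap.proj (φ := fun s : {s : Finset (Fin n) // s.card = i} =>
          Localization.Away (∏ k ∈ s.1, x k))
          ⟨t.1.erase j.1, by rw [Finset.card_erase_of_mem j.2, t.2, Nat.add_sub_cancel]⟩)

theorem cechRes_comp {s t u : Finset (Fin n)}
   (h : s ⊆ t) (h' : t ⊆ u) (a : Localization.Away (∏ k ∈ s, x k)) :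
    cechRes x h' (cechRes x h a) = cechRes x (h.trans h') a := by
  rw [← AlgHom.comp_apply]
  congr 1
  exact IsLocalization.algHom_ext (Submonoid.powers (∏ k ∈ s, x k)) (Subsingleton.elim _ _)

/-- The Čech complex is a complex. -/
theorem cechD_cechD (i : ℕ) (a : CechCochain x i) :
    cechD x (i+1) (cechD x i a) = 0 := by
  have key : ∀ (t : {s : Finset (Fin n) // s.card = i+1+1}) (s s': {s : Finset (Fin n) // s.card = i})
     (h : s.1 ⊆ t.1) (h' : s'.1 ⊆ t.1), s = s' → cechRes x h (a s) = cechRes x h' (a s') := by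
    rintro t s s' h h' rfl; rfl
  ext t
  simp only [cechD, LinearMap.pi_apply, LinearMap.sum_apply, map_sum, LinearMap.smul_apply,
    LinearMap.comp_apply, LinearMap.proj_apply, map_smul, AlgHom.toLinearMap_apply, cechRes_comp, Finset.smul_sum, smul_smul]
  rw [Finset.sum_sigma']
  refine Finset.sum_involution (fun q _ => ⟨⟨q.2.1, (Finset.mem_erase.1 q.2.2).2⟩, ⟨q.1.1, Finset.mem_erase.2 ⟨(Finset.mem_erase.1 q.2.2).1.symm, q.1.2⟩⟩⟩) ?_ ?_ ?_ ?_
  · rintro ⟨⟨j, hj⟩, ⟨k, hk⟩⟩ _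
    dsimp only
    have hk' := Finset.mem_erase.1 hk
    rw [key t ⟨(t.1.erase j).erase k, by rw [Finset.card_erase_of_mem hk, Finset.card_erase_of_mem hj, t.2]; rfl⟩ ⟨(t.1.erase k).erase j, by rw [Finset.card_erase_of_mem (Finset.mem_erase.2 ⟨hk'.1.symm, hj⟩), Finset.card_erase_of_mem hk'.2, t.2]; rfl⟩ _ ((Finset.erase_subset _ _).trans (Finset.erase_subset _ _)) (Subtype.ext (Finset.erase_right_comm ..)), ← add_smul]
    have : ∀ (j k : Fin n), j ∈ t.1 → k ∈ t.1 → j < k → (((-1:R)) ^ (t.1.filter (· < j)).card * (-1) ^ ((t.1.erase j).filter (· < k)).card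
        + (-1) ^ (t.1.filter (· < k)).card * (-1) ^ ((t.1.erase k).filter (· < j)).card) = 0 := by
      intro j k hj hk hjk
      have e1 : (t.1.erase k).filter (· < j) = t.1.filter (· < j) := by
        ext l; simp; intro h _; omega
      have e2 : (t.1.filter (· < k)).card = ((t.1.erase j).filter (· < k)).card + 1 := by
        rw [Finset.filter_erase, Finset.card_erase_add_one]; simp [hj, hjk]
      rw [e1, e2, pow_succ]; ring
    rcases lt_or_gt_of_ne hk'.1 with h | h
    · exact (congrArg (· • _) ((add_comm _ _).trans (this k j hk'.2 hj h))).trans (zero_smul _ _)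
    · rw [this j k hj hk'.2 h, zero_smul]
  · rintro ⟨⟨j, hj⟩, ⟨k, hk⟩⟩ _ _ h
    have hk' := Finset.mem_erase.1 hk
    simp at h; exact hk'.1 h.1
  · intros; simp
  · rintro ⟨⟨j, hj⟩, ⟨k, hk⟩⟩ _; rfl

/-- The Čech coboundaries in degree `i`. -/
def cechB : ∀ i : ℕ, Submodule R (CechCochain x i)
  | 0 => ⊥
  | i + 1 => LinearMap.range (cechD x i)

/-- The cohomology `H^i` of the Čech complex of `R` on `x_1, …, x_n`. When `R` is Noetherian this
is the local cohomology module `H^i_I(R)` for every ideal `I` with the same radical as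
`(x_1, …, x_n)`. -/
abbrev CechCohomology (i : ℕ) : Type _ :=
  LinearMap.ker (cechD x i) ⧸ (cechB x i).submoduleOf (LinearMap.ker (cechD x i))

end Cech

section Frobenius

variable (R : Type*) [CommRing R] (p : ℕ) [Fact p.Prime] [CharP R p]

/-- The `e`-th iterate `a ↦ a^{p^e}` of the Frobenius of an algebra over a ring of
characteristic `p` (possibly the zero algebra), as a semilinear map. -/
def algFrob (A : Type*) [CommRing A] [Algebra R A] (e : ℕ) :
    A →ₛₗ[iterateFrobenius R p e] A where
  toFun a := a ^ p ^ e
  map_add' a b := by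
    rcases subsingleton_or_nontrivial A with h | h
    · exact Subsingleton.elim _ _
    · have hp : (p : A) = 0 := by
        rw [← map_natCast (algebraMap R A), CharP.cast_eq_zero, map_zero]
      have : CharP A p := (CharP.charP_iff_prime_eq_zero Fact.out).2 hp
      exact add_pow_char_pow a b p e
  map_smul' r a := by
    simp [Algebra.smul_def, mul_pow, iterateFrobenius_def]

variable {R} {n : ℕ} (x : Fin n → R)

/-- The `e`-th iterate of Frobenius on each term of the Čech complex. -/
def cechFrob (e i : ℕ) : CechCochain x i →ₛₗ[iterateFrobenius R p e] CechCochain x i where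
  toFun a s := algFrob R p _ e (a s)
  map_add' a b := funext fun s => map_add (algFrob R p _ e) (a s) (b s)
  map_smul' r a := funext fun s => map_smulₛₗ (algFrob R p _ e) r (a s)

theorem cechD_cechFrob (e i : ℕ) (a : CechCochain x i) :
    cechD x i (cechFrob p x e i a) = cechFrob p x e (i + 1) (cechD x i a) := by
  have hs : ∀ m : ℕ, iterateFrobenius R p e ((-1 : R) ^ m) = (-1) ^ m := fun m => by
    rw [map_pow, map_neg, map_one]
  ext t
  change _ = algFrob R p _ e (cechD x i a t)
  simp only [cechD, LinearMap.pi_apply, LinearMap.sum_apply, map_sum, LinearMap.smul_apply,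
    LinearMap.comp_apply, LinearMap.proj_apply, LinearMap.map_smulₛₗ, hs]
  refine Finset.sum_congr rfl fun j _ => ?_
  congr 1
  exact map_pow (cechRes x (Finset.erase_subset j.1 t.1)) _ _

/-- The `e`-th iterate of the Frobenius action on `H^i`: the class of a cocycle `(a_s)_s` goes to
the class of `(a_s^{p^e})_s`. -/
def frobeniusAction (e i : ℕ) :
    CechCohomology x i →ₛₗ[iterateFrobenius R p e] CechCohomology x i :=
  Submodule.mapQ _ _
    ((cechFrob p x e i).restrict (p := LinearMap.ker (cechD x i))
      (q := LinearMap.ker (cechD x i)) fun a ha => by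
        rw [LinearMap.mem_ker] at ha ⊢
        rw [cechD_cechFrob, ha, map_zero])
    (by
      rintro ⟨a, ha⟩ hb
      change a ∈ cechB x i at hb
      change cechFrob p x e i a ∈ cechB x i
      cases i with
      | zero =>
        have h0 : a = 0 := hb
        rw [h0, map_zero]
        exact Submodule.zero_mem _
      | succ i =>
        obtain ⟨b, rfl⟩ := hb
        exact ⟨cechFrob p x e i b, cechD_cechFrob p x e i b⟩)

/-- `0^F_{H^i}`: the elements killed by all large iterates of the Frobenius action. -/
def frobeniusClosureZero (i : ℕ) : Set (CechCohomology x i) :=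
  {η | ∃ e₀ : ℕ, ∀ e ≥ e₀, frobeniusAction p x e i η = 0}

end Frobenius

section TightClosure

variable (R : Type*) [CommRing R] (p : ℕ) [Fact p.Prime] [CharP R p]

/-- `F^e_* R`: the additive group `R` on which `r : R` acts as multiplication by `r^{p^e}`. -/
@[nolint unusedArguments]
def FrobeniusPushforward (_p _e : ℕ) : Type _ := R

instance (e : ℕ) : AddCommGroup (FrobeniusPushforward R p e) :=
  inferInstanceAs (AddCommGroup R)

instance (e : ℕ) : Module R (FrobeniusPushforward R p e) :=
  Module.compHom R (iterateFrobenius R p e)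

/-- `F^e_* c`: the element `c` of `R`, viewed in `F^e_* R`. -/
def frobeniusPushforwardOf (e : ℕ) (c : R) : FrobeniusPushforward R p e := c

/-- `0^*_M`, the tight closure of zero in the `R`-module `M`: the elements `m` for which there is
`c` outside all minimal primes of `R` such that `m` goes to zero under
`M → M ⊗_R F^e_* R → M ⊗_R F^e_* R`, `m ↦ m ⊗ 1 ↦ m ⊗ c`, for all large `e`. -/
def tightClosureZero (M : Type*) [AddCommGroup M] [Module R M] : Set M :=
  {m | ∃ c : R, (∀ P ∈ minimalPrimes R, c ∉ P) ∧
    ∃ e₀ : ℕ, ∀ e ≥ e₀, m ⊗ₜ[R] frobeniusPushforwardOf R p e c = 0}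

end TightClosure

section Local

variable {R : Type*} [CommRing R] [IsLocalRing R]

/-- `x_1, …, x_d` is a system of parameters of the local ring `R`: `d = dim R` and the ideal
`(x_1, …, x_d)` is primary to the maximal ideal. -/
def IsSystemOfParameters {d : ℕ} (x : Fin d → R) : Prop :=
  ringKrullDim R = d ∧
    (Ideal.span (Set.range x)).radical = IsLocalRing.maximalIdeal R

variable (R) (p : ℕ) [Fact p.Prime] [CharP R p]

/-- `R` is weakly `F`-nilpotent: `0^F_{H^i} = H^i` for `H^i = H^i_𝔪(R)` and `0 ≤ i < d = dim R`.
Here `H^i_𝔪(R)` is computed by the Čech complex on a system of parameters; up to isomorphism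
respecting the Frobenius actions all systems of parameters give the same module. -/
def IsWeaklyFNilpotent : Prop :=
  ∀ (d : ℕ) (x : Fin d → R), IsSystemOfParameters x →
    ∀ i < d, frobeniusClosureZero p x i = Set.univ

/-- `R` is `F`-nilpotent: it is weakly `F`-nilpotent and `0^*_{H^d} = 0^F_{H^d}` for
`H^d = H^d_𝔪(R)`, `d = dim R`. -/
def IsFNilpotent : Prop :=
  IsWeaklyFNilpotent R p ∧
    ∀ (d : ℕ) (x : Fin d → R), IsSystemOfParameters x →
      tightClosureZero R p (CechCohomology x d) = frobeniusClosureZero p x d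

end Local

end FNil

end

/-!
Let `f : R → S` be a `p`-radical local homomorphism and `y` a system of parameters of `S`. For a
large `r` each `y_k ^ p ^ r` is some `f (x_k)`, and since `Spec S → Spec R` is a homeomorphism the
`x_k` form a system of parameters of `R` (`exists_isSystemOfParameters`). As `y_k` and
`y_k ^ p ^ r` define the same localizations, `f` induces a map from the Čech complex of `x` to that
of `y` (`cechMap`, `cochainMap`). Each component `R_{x_s} → S_{y_s}` is again `p`-radical, so
every Čech cocycle over `S` becomes the image of a cocycle over `R` after a Frobenius power
(`exists_cocycle_cochainMap_eq`). If Frobenius is nilpotent on `H^i` of `R`, it is therefore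
nilpotent on `H^i` of `S`.

In the top degree `d`, the class of `b / (x_1 ⋯ x_d) ^ m` vanishes iff
`(x_1 ⋯ x_d) ^ l * b ∈ (x_1 ^ (m + l), …, x_d ^ (m + l))` for some `l` (`mem_cechB_top_iff`). This
explicit criterion has two consequences. First, `η ⊗ F^e_* c = 0` iff `c F^e(η) = 0` for
`η ∈ H^d`, so that membership in `0^*` is a statement about the Frobenius action
(`cechClass_mem_tightClosureZero_iff`). Second, if ideals of `R` are contracted from `S`, then
`H^d` of `R` injects into `H^d` of `S` (`mem_cechB_of_cochainMap_mem`). Now let `η ∈ 0^*` over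
`S`, with multiplier `c`. Some `F^{e₁}(η)` is the image of a class `ξ` over `R`, some `c ^ p ^ e₂` is
the image of an element `c'` of `R` outside all minimal primes, and by injectivity
`c' F^e(ξ) = 0` for large `e`. Thus `ξ ∈ 0^* = 0^F` over `R`, and `η ∈ 0^F` over `S`.
-/

namespace FNil

open Filter

/-! ### Elements and differentials of the Čech complex -/

section Cech

variable {R : Type*} [CommRing R] {n : ℕ} (x : Fin n → R)

theorem isUnit_algebraMap_prod_pow (s : Finset (Fin n)) (m : ℕ) :
    IsUnit (algebraMap R (Localization.Away (∏ k ∈ s, x k)) (∏ k ∈ s, x k) ^ m) :=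
  (IsLocalization.Away.algebraMap_isUnit (∏ k ∈ s, x k)).pow m

theorem exists_mul_prod_pow_eq (s : Finset (Fin n)) (m : ℕ)
    (a : Localization.Away (∏ k ∈ s, x k)) :
    ∃ c, c * algebraMap R _ (∏ k ∈ s, x k) ^ m = a := by
  obtain ⟨u, hu⟩ := (isUnit_algebraMap_prod_pow x s m).exists_left_inv
  exact ⟨a * u, by rw [mul_assoc, hu, mul_one]⟩

theorem cechD_apply (i : ℕ) (a : CechCochain x i) (t : {t : Finset (Fin n) // t.card = i + 1}) :
    cechD x i a t = ∑ j : {j // j ∈ t.1}, ((-1 : R) ^ (t.1.filter (fun k => k < j.1)).card) •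
      cechRes x (Finset.erase_subset j.1 t.1) (a ⟨t.1.erase j.1, by
        rw [Finset.card_erase_of_mem j.2, t.2, Nat.add_sub_cancel]⟩) := by
  simp only [cechD, LinearMap.pi_apply, LinearMap.sum_apply, LinearMap.smul_apply,
    LinearMap.comp_apply, LinearMap.proj_apply, AlgHom.toLinearMap_apply]

end Cech

/-! ### Functoriality of the Čech complex -/

section BaseChange

variable {R S : Type*} [CommRing R] [CommRing S] {n : ℕ} {x : Fin n → R} {y : Fin n → S}
  (f : R →+* S) {q : ℕ}

theorem map_prod_eq_pow (h : ∀ k, f (x k) = y k ^ q) (s : Finset (Fin n)) :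
    f (∏ k ∈ s, x k) = (∏ k ∈ s, y k) ^ q := by
  rw [map_prod, ← Finset.prod_pow]
  exact Finset.prod_congr rfl fun k _ => h k

/-- The ring homomorphism `R_{x_s} → S_{y_s}` induced by `f : R → S` when `f(x_k) = y_k ^ q`. -/
noncomputable def cechMap (h : ∀ k, f (x k) = y k ^ q) (s : Finset (Fin n)) :
    Localization.Away (∏ k ∈ s, x k) →+* Localization.Away (∏ k ∈ s, y k) :=
  IsLocalization.Away.lift (∏ k ∈ s, x k) (g := (algebraMap S _).comp f) (by
    rw [RingHom.comp_apply, map_prod_eq_pow f h, map_pow]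
    exact isUnit_algebraMap_prod_pow y s q)

variable (h : ∀ k, f (x k) = y k ^ q)

@[simp]
theorem cechMap_algebraMap (s : Finset (Fin n)) (r : R) :
    cechMap f h s (algebraMap R _ r) = algebraMap S _ (f r) :=
  IsLocalization.Away.lift_eq _ _ r

theorem cechMap_smul (s : Finset (Fin n)) (r : R) (a : Localization.Away (∏ k ∈ s, x k)) :
    cechMap f h s (r • a) = f r • cechMap f h s a := by
  rw [Algebra.smul_def, map_mul, cechMap_algebraMap, Algebra.smul_def]

theorem cechMap_cechRes {s t : Finset (Fin n)} (hst : s ⊆ t)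
    (a : Localization.Away (∏ k ∈ s, x k)) :
    cechMap f h t (cechRes x hst a) = cechRes y hst (cechMap f h s a) := by
  have key : (cechMap f h t).comp (cechRes x hst).toRingHom =
      (cechRes y hst).toRingHom.comp (cechMap f h s) := by
    refine IsLocalization.ringHom_ext (Submonoid.powers (∏ k ∈ s, x k)) (RingHom.ext fun r => ?_)
    simp only [RingHom.comp_apply, cechMap_algebraMap, AlgHom.toRingHom_eq_coe, RingHom.coe_coe,
      AlgHom.commutes]
  exact RingHom.congr_fun key a

/-- The map of Čech cochains induced by `f : R → S` when `f(x_k) = y_k ^ q`. -/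
noncomputable def cochainMap (i : ℕ) (a : CechCochain x i) : CechCochain y i :=
  fun s => cechMap f h s.1 (a s)

theorem cechD_cochainMap (i : ℕ) (a : CechCochain x i) :
    cechD y i (cochainMap f h i a) = cochainMap f h (i + 1) (cechD x i a) := by
  ext t
  simp only [cochainMap, cechD_apply, map_sum, cechMap_smul, cechMap_cechRes, map_pow, map_neg,
    map_one]

theorem cochainMap_mem_cechB {i : ℕ} {a : CechCochain x i} (ha : a ∈ cechB x i) :
    cochainMap f h i a ∈ cechB y i := by
  cases i with
  | zero =>
    obtain rfl : a = 0 := ha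
    exact (Submodule.mem_bot S).2 (funext fun s => map_zero _)
  | succ i =>
    obtain ⟨b, rfl⟩ := ha
    exact ⟨cochainMap f h i b, cechD_cochainMap f h i b⟩

theorem cochainMap_smul (i : ℕ) (r : R) (a : CechCochain x i) :
    cochainMap f h i (r • a) = f r • cochainMap f h i a :=
  funext fun s => cechMap_smul f h s.1 r (a s)

end BaseChange

/-! ### The Frobenius action on Čech classes -/

section Frobenius

variable {R : Type*} [CommRing R] (p : ℕ) [Fact p.Prime] [CharP R p] {n : ℕ} (x : Fin n → R)

theorem cechFrob_apply (e i : ℕ) (a : CechCochain x i)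
    (s : {s : Finset (Fin n) // s.card = i}) : cechFrob p x e i a s = a s ^ p ^ e :=
  rfl

theorem cechFrob_cechFrob (e e' i : ℕ) (a : CechCochain x i) :
    cechFrob p x e' i (cechFrob p x e i a) = cechFrob p x (e' + e) i a := by
  funext s
  simp only [cechFrob_apply]
  rw [← pow_mul, ← pow_add, add_comm]

theorem cechFrob_mem_cechB (e : ℕ) {i : ℕ} {a : CechCochain x i} (ha : a ∈ cechB x i) :
    cechFrob p x e i a ∈ cechB x i := by
  cases i with
  | zero =>
    obtain rfl : a = 0 := ha
    rw [map_zero]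
    exact Submodule.zero_mem _
  | succ i =>
    obtain ⟨b, rfl⟩ := ha
    exact ⟨cechFrob p x e i b, cechD_cechFrob p x e i b⟩

/-- The class of a Čech cocycle. -/
noncomputable abbrev cechClass {i : ℕ} (a : CechCochain x i) (ha : cechD x i a = 0) :
    CechCohomology x i :=
  Submodule.Quotient.mk ⟨a, ha⟩

theorem exists_cechClass_eq {i : ℕ} (η : CechCohomology x i) :
    ∃ a, ∃ ha : cechD x i a = 0, cechClass x a ha = η := by
  obtain ⟨⟨a, ha⟩, rfl⟩ := Submodule.Quotient.mk_surjective _ η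
  exact ⟨a, ha, rfl⟩

theorem cechClass_eq_zero_iff {i : ℕ} {a : CechCochain x i} (ha : cechD x i a = 0) :
    cechClass x a ha = 0 ↔ a ∈ cechB x i :=
  Submodule.Quotient.mk_eq_zero _

theorem cechD_cechFrob_eq_zero (e : ℕ) {i : ℕ} {a : CechCochain x i} (ha : cechD x i a = 0) :
    cechD x i (cechFrob p x e i a) = 0 := by
  rw [cechD_cechFrob, ha, map_zero]

theorem frobeniusAction_cechClass (e : ℕ) {i : ℕ} {a : CechCochain x i} (ha : cechD x i a = 0) :
    frobeniusAction p x e i (cechClass x a ha) =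
      cechClass x (cechFrob p x e i a) (cechD_cechFrob_eq_zero p x e ha) :=
  rfl

theorem cechClass_mem_frobeniusClosureZero_iff {i : ℕ} {a : CechCochain x i}
    (ha : cechD x i a = 0) :
    cechClass x a ha ∈ frobeniusClosureZero p x i ↔ ∃ e, cechFrob p x e i a ∈ cechB x i := by
  simp only [frobeniusClosureZero, Set.mem_ofPred_eq, frobeniusAction_cechClass,
    cechClass_eq_zero_iff]
  refine ⟨fun ⟨e, he⟩ => ⟨e, he e le_rfl⟩, fun ⟨e, he⟩ => ⟨e, fun e' hee' => ?_⟩⟩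
  rw [← Nat.sub_add_cancel hee', ← cechFrob_cechFrob]
  exact cechFrob_mem_cechB p x _ he

end Frobenius

/-! ### The Čech complex along a `p`-radical homomorphism -/

section PRadical

variable {R S : Type*} [CommRing R] [CommRing S] {n : ℕ} {x : Fin n → R} {y : Fin n → S}
  {f : R →+* S} {p : ℕ} {r : ℕ}

theorem eventually_exists_map_eq_pow (hf : IsPRadical f p) (b : S) :
    ∀ᶠ e in atTop, ∃ c, f c = b ^ p ^ e := by
  obtain ⟨e₀, c, hc⟩ := hf.pow_mem' b
  filter_upwards [eventually_ge_atTop e₀] with e he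
  exact ⟨c ^ p ^ (e - e₀), by
    rw [map_pow, hc, ← pow_mul, ← pow_add, Nat.add_sub_cancel' he]⟩

theorem ker_le_nilradical (hf : IsPRadical f p) : RingHom.ker f ≤ nilradical R :=
  hf.ker_le'.trans (pNilradical_le_nilradical)

/-- A `p`-radical homomorphism stays `p`-radical after localization: some Frobenius power of each
element of `S_{y_s}` comes from `R_{x_s}`. -/
theorem eventually_exists_cechMap_eq_pow (hf : IsPRadical f p) (h : ∀ k, f (x k) = y k ^ p ^ r)
    (s : Finset (Fin n)) (z : Localization.Away (∏ k ∈ s, y k)) :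
    ∀ᶠ e in atTop, ∃ c, cechMap f h s c = z ^ p ^ e := by
  obtain ⟨m, b, hb⟩ := IsLocalization.Away.surj (∏ k ∈ s, y k) z
  filter_upwards [eventually_exists_map_eq_pow hf b, eventually_ge_atTop r] with e ⟨w, hw⟩ he
  obtain ⟨c, hc⟩ := exists_mul_prod_pow_eq x s (m * p ^ (e - r)) (algebraMap R _ w)
  refine ⟨c, (isUnit_algebraMap_prod_pow y s (m * p ^ e)).mul_right_cancel ?_⟩
  have h1 := congrArg (cechMap f h s) hc
  rw [map_mul, map_pow, cechMap_algebraMap, cechMap_algebraMap, hw, map_prod_eq_pow f h,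
    map_pow, map_pow, ← hb, ← pow_mul, mul_left_comm, ← pow_add, Nat.add_sub_cancel' he] at h1
  rw [h1, mul_pow, pow_mul]

theorem isNilpotent_of_cechMap_eq_zero (hf : IsPRadical f p)
    (h : ∀ k, f (x k) = y k ^ p ^ r) (hp : 0 < p) {s : Finset (Fin n)}
    {z : Localization.Away (∏ k ∈ s, x k)} (hz : cechMap f h s z = 0) : IsNilpotent z := by
  obtain ⟨m, b, hb⟩ := IsLocalization.Away.surj (∏ k ∈ s, x k) z
  have h1 : algebraMap S (Localization.Away (∏ k ∈ s, y k)) (f b) = algebraMap S _ 0 := by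
    rw [← cechMap_algebraMap f h, ← hb, map_mul, hz, zero_mul, map_zero]
  obtain ⟨k, hk⟩ := IsLocalization.Away.exists_of_eq (∏ k ∈ s, y k) h1
  -- Raising the exponent to a multiple of `p ^ r` makes the annihilating power come from `R`.
  have h2 : f ((∏ k ∈ s, x k) ^ k * b) = 0 := by
    rw [map_mul, map_pow, map_prod_eq_pow f h, ← pow_mul,
      ← Nat.sub_add_cancel (Nat.le_mul_of_pos_left k (pow_pos hp r)), pow_add, mul_assoc, hk,
      mul_zero, mul_zero]
  have h3 : IsNilpotent ((∏ k ∈ s, x k) ^ k * b) := ker_le_nilradical hf h2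
  have h4 := h3.map (algebraMap R (Localization.Away (∏ k ∈ s, x k)))
  rw [map_mul, ← hb, map_pow, mul_left_comm, ← pow_add] at h4
  obtain ⟨N, hN⟩ := h4
  refine ⟨N, (isUnit_algebraMap_prod_pow x s ((k + m) * N)).mul_right_cancel ?_⟩
  rw [zero_mul, pow_mul, ← mul_pow, hN]

theorem isHomeomorph_comap [Fact p.Prime] (hf : IsPRadical f p) :
    IsHomeomorph (PrimeSpectrum.comap f) :=
  PrimeSpectrum.isHomeomorph_comap f (fun s => by
    obtain ⟨e, c, hc⟩ := hf.pow_mem' s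
    exact ⟨p ^ e, pow_pos (Fact.out : p.Prime).pos e, c, hc⟩) (ker_le_nilradical hf)

theorem ringKrullDim_eq [Fact p.Prime] (hf : IsPRadical f p) : ringKrullDim S = ringKrullDim R := by
  rw [← PrimeSpectrum.topologicalKrullDim_eq_ringKrullDim,
    ← PrimeSpectrum.topologicalKrullDim_eq_ringKrullDim]
  exact (isHomeomorph_comap hf).topologicalKrullDim_eq _

/-- Frobenius powers of a system of parameters of `S` lift to a system of parameters of `R`. -/
theorem exists_isSystemOfParameters [Fact p.Prime] [IsLocalRing R] [IsLocalRing S] [IsLocalHom f]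
    (hf : IsPRadical f p) (hy : IsSystemOfParameters y) :
    ∃ (r : ℕ) (x : Fin n → R), (∀ k, f (x k) = y k ^ p ^ r) ∧ IsSystemOfParameters x := by
  obtain ⟨r, hr⟩ := (eventually_all.2 fun k => eventually_exists_map_eq_pow hf (y k)).exists
  choose x hx using hr
  have hpr : p ^ r ≠ 0 := pow_ne_zero r (Fact.out : p.Prime).ne_zero
  refine ⟨r, x, hx, (ringKrullDim_eq hf).symm.trans hy.1, le_antisymm ?_ ?_⟩
  · refine (IsLocalRing.maximalIdeal.isMaximal R).isPrime.radical_le_iff.2 (Ideal.span_le.2 ?_)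
    rintro _ ⟨k, rfl⟩
    rw [SetLike.mem_coe, IsLocalRing.mem_maximalIdeal, mem_nonunits_iff, ← isUnit_map_iff f, hx,
      isUnit_pow_iff hpr, ← mem_nonunits_iff, ← IsLocalRing.mem_maximalIdeal, ← hy.2]
    exact Ideal.le_radical (Ideal.subset_span ⟨k, rfl⟩)
  · rw [Ideal.radical_eq_sInf]
    refine le_sInf fun P ⟨hxP, hP⟩ => ?_
    obtain ⟨Q, hQ⟩ := (isHomeomorph_comap hf).surjective ⟨P, hP⟩
    have hQP : Q.asIdeal.comap f = P := congrArg PrimeSpectrum.asIdeal hQ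
    have hyQ : (Ideal.span (Set.range y)).radical ≤ Q.asIdeal := by
      refine Q.2.radical_le_iff.2 (Ideal.span_le.2 ?_)
      rintro _ ⟨k, rfl⟩
      refine Q.2.mem_of_pow_mem (p ^ r) ?_
      rw [← hx, ← Ideal.mem_comap, hQP]
      exact hxP (Ideal.subset_span ⟨k, rfl⟩)
    intro a ha
    rw [← hQP, Ideal.mem_comap]
    refine hyQ (hy.2 ▸ ?_)
    rwa [IsLocalRing.mem_maximalIdeal, mem_nonunits_iff, isUnit_map_iff]

variable [Fact p.Prime] [CharP R p] [CharP S p]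

theorem cochainMap_cechFrob (h : ∀ k, f (x k) = y k ^ r) (e i : ℕ) (a : CechCochain x i) :
    cochainMap f h i (cechFrob p x e i a) = cechFrob p y e i (cochainMap f h i a) :=
  funext fun s => map_pow (cechMap f h s.1) (a s) (p ^ e)

/-- Every cocycle over `S` becomes, after a Frobenius power, the image of a cocycle over `R`. -/
theorem exists_cocycle_cochainMap_eq (hf : IsPRadical f p) (h : ∀ k, f (x k) = y k ^ p ^ r)
    {i : ℕ} {a : CechCochain y i} (ha : cechD y i a = 0) :
    ∃ (e : ℕ) (c : CechCochain x i), cechD x i c = 0 ∧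
      cochainMap f h i c = cechFrob p y e i a := by
  have hp : p.Prime := Fact.out
  have hev : ∀ s, ∀ᶠ e in atTop, ∃ c, cechMap f h s.1 c = a s ^ p ^ e := fun s =>
    eventually_exists_cechMap_eq_pow hf h s.1 (a s)
  obtain ⟨e, he⟩ := (eventually_all.2 hev).exists
  obtain ⟨c, hc'⟩ : ∃ c : CechCochain x i, cochainMap f h i c = cechFrob p y e i a :=
    ⟨fun s => (he s).choose, funext fun s => (he s).choose_spec⟩
  -- The cochain `c` need not be a cocycle, but its coboundary has nilpotent components.
  have hnil : ∀ t, ∀ᶠ e' in atTop, cechD x i c t ^ p ^ e' = 0 := fun t => by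
    have h0 : cochainMap f h (i + 1) (cechD x i c) = 0 := by
      rw [← cechD_cochainMap, hc', cechD_cechFrob, ha, map_zero]
    obtain ⟨N, hN⟩ := isNilpotent_of_cechMap_eq_zero hf h hp.pos (congrFun h0 t)
    filter_upwards [eventually_ge_atTop N] with e' he'
    exact pow_eq_zero_of_le (he'.trans (Nat.lt_pow_self hp.one_lt).le) hN
  obtain ⟨e', he'⟩ := (eventually_all.2 hnil).exists
  refine ⟨e' + e, cechFrob p x e' i c, ?_, ?_⟩
  · rw [cechD_cechFrob]
    exact funext he'
  · rw [cochainMap_cechFrob, hc', cechFrob_cechFrob]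

theorem isWeaklyFNilpotent_of_isPRadical [IsLocalRing R] [IsLocalRing S] [IsLocalHom f]
    (hf : IsPRadical f p) (hR : IsWeaklyFNilpotent R p) : IsWeaklyFNilpotent S p := by
  intro d y hy i hi
  obtain ⟨r, x, h, hx⟩ := exists_isSystemOfParameters hf hy
  refine Set.eq_univ_of_forall fun η => ?_
  obtain ⟨a, ha, rfl⟩ := exists_cechClass_eq y η
  obtain ⟨e, c, hc, hca⟩ := exists_cocycle_cochainMap_eq hf h ha
  have hcR : cechClass x c hc ∈ frobeniusClosureZero p x i := by
    rw [hR d x hx i hi]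
    trivial
  obtain ⟨e', he'⟩ := (cechClass_mem_frobeniusClosureZero_iff p x hc).1 hcR
  refine (cechClass_mem_frobeniusClosureZero_iff p y ha).2 ⟨e' + e, ?_⟩
  rw [← cechFrob_cechFrob, ← hca, ← cochainMap_cechFrob]
  exact cochainMap_mem_cechB f h he'

end PRadical

/-! ### Coboundaries in top degree -/

section TopDegree

variable {R : Type*} [CommRing R] {n : ℕ} {x : Fin n → R}

theorem exists_cochain_mul_pow_eq (x : Fin n → R) (i N : ℕ) (w : R) :
    ∃ a : CechCochain x i, ∀ s, a s * algebraMap R _ (∏ k ∈ s.1, x k) ^ N = algebraMap R _ w :=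
  ⟨fun s => (exists_mul_prod_pow_eq x s.1 N (algebraMap R _ w)).choose,
    fun s => (exists_mul_prod_pow_eq x s.1 N (algebraMap R _ w)).choose_spec⟩

/-- The only index of the top term of the Čech complex. -/
abbrev topIndex (n : ℕ) : {s : Finset (Fin n) // s.card = n} :=
  ⟨Finset.univ, Finset.card_fin n⟩

theorem eq_topIndex (s : {s : Finset (Fin n) // s.card = n}) : s = topIndex n :=
  Subtype.ext ((Finset.card_eq_iff_eq_univ _).1 (s.2.trans (Fintype.card_fin n).symm))

theorem cochain_top_ext {a b : CechCochain x n} (h : a (topIndex n) = b (topIndex n)) : a = b := by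
  funext s
  obtain rfl := eq_topIndex s
  exact h

theorem cechD_top (a : CechCochain x n) : cechD x n a = 0 := by
  funext t
  exact absurd (t.2.symm.le.trans (Finset.card_le_univ t.1)) (by simp)

theorem cochain_top_eq_of_mul_pow_eq {N : ℕ} {a b : CechCochain x n}
    (h : a (topIndex n) * algebraMap R _ (∏ k, x k) ^ N =
      b (topIndex n) * algebraMap R _ (∏ k, x k) ^ N) : a = b :=
  cochain_top_ext ((isUnit_algebraMap_prod_pow x Finset.univ N).mul_right_cancel h)

theorem prod_pow_mul_mem_span {N : ℕ} {w : R}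
    (hw : w ∈ Ideal.span (Set.range fun i => x i ^ N)) (l : ℕ) :
    (∏ k, x k) ^ l * w ∈ Ideal.span (Set.range fun i => x i ^ (N + l)) := by
  induction hw using Submodule.span_induction with
  | mem w hw =>
    obtain ⟨i, rfl⟩ := hw
    refine Ideal.mem_of_dvd _ ?_ (Ideal.subset_span ⟨i, rfl⟩)
    dsimp only
    rw [pow_add, mul_comm]
    exact mul_dvd_mul_right (pow_dvd_pow_of_dvd (Finset.dvd_prod_of_mem x (Finset.mem_univ i)) l) _
  | zero => simp
  | add w w' _ _ hw hw' => rw [mul_add]; exact add_mem hw hw'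
  | smul r w _ hw =>
    rw [smul_eq_mul, mul_left_comm]
    exact Ideal.mul_mem_left _ r hw

theorem cechRes_mul_prod_pow (s : Finset (Fin n)) {j : Fin n} (hj : j ∈ s) {N : ℕ} {r : R}
    {c : Localization.Away (∏ k ∈ s.erase j, x k)}
    (hc : c * algebraMap R _ (∏ k ∈ s.erase j, x k) ^ N = algebraMap R _ r) :
    cechRes x (Finset.erase_subset j s) c * algebraMap R _ (∏ k ∈ s, x k) ^ N =
      algebraMap R _ (r * x j ^ N) := by
  have hs : algebraMap R (Localization.Away (∏ k ∈ s, x k)) (∏ k ∈ s, x k) =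
      algebraMap R _ (∏ k ∈ s.erase j, x k) * algebraMap R _ (x j) := by
    rw [← map_mul, Finset.prod_erase_mul s x hj]
  rw [hs, mul_pow, ← mul_assoc,
    ← (cechRes x (Finset.erase_subset j s)).commutes (∏ k ∈ s.erase j, x k), ← map_pow, ← map_mul,
    hc, AlgHom.commutes, map_mul, map_pow]

/-- The class of `x_i ^ N / (x_1 ⋯ x_n) ^ N` vanishes: it equals `1 / (∏_{k ≠ i} x_k) ^ N`, so up to
sign it is the coboundary of the cochain with that component at the complement of `i`. -/
theorem mem_cechB_of_mul_pow_eq_pow {N : ℕ} {i : Fin n} {a : CechCochain x n}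
    (ha : a (topIndex n) * algebraMap R _ (∏ k, x k) ^ N = algebraMap R _ (x i ^ N)) :
    a ∈ cechB x n := by
  obtain _ | n := n
  · exact i.elim0
  obtain ⟨c, hc⟩ := exists_mul_prod_pow_eq x (Finset.univ.erase i) N (algebraMap R _ 1)
  let ε : R := (-1) ^ (Finset.univ.filter (fun k => k < i)).card
  have hε : ε * ε = 1 := by
    rw [← mul_pow, neg_one_mul, neg_neg, one_pow]
  have hcard : ∀ j : Fin (n + 1), (Finset.univ.erase j).card = n := fun j => by
    rw [Finset.card_erase_of_mem (Finset.mem_univ j), Finset.card_fin, Nat.add_sub_cancel]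
  -- The cochain concentrated on the complement of `i`.
  let b : CechCochain x n := Pi.single ⟨Finset.univ.erase i, hcard i⟩ (ε • c)
  refine ⟨b, cochain_top_eq_of_mul_pow_eq (N := N) ?_⟩
  have hb : cechD x n b (topIndex (n + 1)) =
      cechRes x (Finset.erase_subset i Finset.univ) c := by
    rw [cechD_apply, Finset.sum_eq_single ⟨i, Finset.mem_univ i⟩]
    · dsimp only [b]
      rw [Pi.single_eq_same, map_smul, smul_smul]
      exact (congrArg (· • _) hε).trans (one_smul R _)
    · rintro ⟨j, hj⟩ _ hji
      dsimp only [b]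
      rw [Pi.single_eq_of_ne, map_zero, smul_zero]
      intro h
      refine hji (Subtype.ext ?_)
      by_contra hne
      have hi : i ∈ Finset.univ.erase j :=
        Finset.mem_erase.2 ⟨fun h => hne h.symm, Finset.mem_univ i⟩
      rw [show Finset.univ.erase j = Finset.univ.erase i from congrArg Subtype.val h] at hi
      exact Finset.notMem_erase i _ hi
    · exact fun h => absurd (Finset.mem_univ _) h
  rw [hb, cechRes_mul_prod_pow Finset.univ (Finset.mem_univ i) hc, ha, one_mul]

theorem mem_cechB_of_mul_pow_eq {N : ℕ} {w : R}
    (hw : w ∈ Ideal.span (Set.range fun i => x i ^ N)) {a : CechCochain x n}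
    (ha : a (topIndex n) * algebraMap R _ (∏ k, x k) ^ N = algebraMap R _ w) :
    a ∈ cechB x n := by
  induction hw using Submodule.span_induction generalizing a with
  | mem w hw =>
    obtain ⟨i, rfl⟩ := hw
    exact mem_cechB_of_mul_pow_eq_pow ha
  | zero =>
    rw [cochain_top_eq_of_mul_pow_eq (a := a) (b := 0) (N := N) (by
      rw [ha, map_zero, Pi.zero_apply, zero_mul])]
    exact Submodule.zero_mem _
  | add w w' _ _ hw hw' =>
    obtain ⟨b, hb⟩ := exists_cochain_mul_pow_eq x n N w
    obtain ⟨b', hb'⟩ := exists_cochain_mul_pow_eq x n N w'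
    rw [cochain_top_eq_of_mul_pow_eq (a := a) (b := b + b') (N := N) (by
      rw [ha, Pi.add_apply, add_mul, hb, hb', map_add])]
    exact add_mem (hw (hb _)) (hw' (hb' _))
  | smul r w _ hw =>
    obtain ⟨b, hb⟩ := exists_cochain_mul_pow_eq x n N w
    rw [cochain_top_eq_of_mul_pow_eq (a := a) (b := r • b) (N := N) (by
      rw [ha, Pi.smul_apply, smul_mul_assoc, hb, smul_eq_mul, map_mul, Algebra.smul_def])]
    exact Submodule.smul_mem _ r (hw (hb _))

theorem eventually_exists_mul_pow_eq (s : Finset (Fin n)) (a : Localization.Away (∏ k ∈ s, x k)) :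
    ∀ᶠ N in atTop, ∃ r, a * algebraMap R _ (∏ k ∈ s, x k) ^ N = algebraMap R _ r := by
  obtain ⟨m, b, hb⟩ := IsLocalization.Away.surj (∏ k ∈ s, x k) a
  filter_upwards [eventually_ge_atTop m] with N hN
  exact ⟨b * (∏ k ∈ s, x k) ^ (N - m), by
    rw [map_mul, ← hb, map_pow, mul_assoc, ← pow_add, Nat.add_sub_cancel' hN]⟩

theorem exists_mul_pow_eq_of_mem_cechB {a : CechCochain x n} (ha : a ∈ cechB x n) :
    ∃ N, ∃ w ∈ Ideal.span (Set.range fun i => x i ^ N),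
      a (topIndex n) * algebraMap R _ (∏ k, x k) ^ N = algebraMap R _ w := by
  obtain _ | n := n
  · obtain rfl : a = 0 := ha
    exact ⟨0, 0, zero_mem _, by rw [Pi.zero_apply, zero_mul, map_zero]⟩
  obtain ⟨b, rfl⟩ := ha
  have hev : ∀ j : {j // j ∈ (topIndex (n + 1)).1}, ∀ᶠ N in atTop, ∃ r,
      b ⟨(topIndex (n + 1)).1.erase j.1, by
        rw [Finset.card_erase_of_mem j.2, (topIndex (n + 1)).2, Nat.add_sub_cancel]⟩ *
        algebraMap R _ (∏ k ∈ (topIndex (n + 1)).1.erase j.1, x k) ^ N = algebraMap R _ r :=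
    fun j => eventually_exists_mul_pow_eq _ _
  obtain ⟨N, hN⟩ := (eventually_all.2 hev).exists
  choose r hr using hN
  refine ⟨N, ∑ j : {j // j ∈ (topIndex (n + 1)).1},
    (-1 : R) ^ ((topIndex (n + 1)).1.filter (fun k => k < j.1)).card * (r j * x j.1 ^ N),
    sum_mem fun j _ => Ideal.mul_mem_left _ _
      (Ideal.mul_mem_left _ _ (Ideal.subset_span ⟨j.1, rfl⟩)), ?_⟩
  rw [cechD_apply, Finset.sum_mul, map_sum]
  refine Finset.sum_congr rfl fun j _ => ?_
  rw [smul_mul_assoc, cechRes_mul_prod_pow _ j.2 (hr j), Algebra.smul_def, ← map_mul]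

/-- The class of `b / (x_1 ⋯ x_n) ^ m` in the top cohomology vanishes iff
`(x_1 ⋯ x_n) ^ l * b ∈ (x_1 ^ (m + l), …, x_n ^ (m + l))` for some `l`. -/
theorem mem_cechB_top_iff {a : CechCochain x n} {b : R} {m : ℕ}
    (hb : a (topIndex n) * algebraMap R _ (∏ k, x k) ^ m = algebraMap R _ b) :
    a ∈ cechB x n ↔
      ∃ l, (∏ k, x k) ^ l * b ∈ Ideal.span (Set.range fun i => x i ^ (m + l)) := by
  constructor
  · intro ha
    obtain ⟨N, w, hw, haw⟩ := exists_mul_pow_eq_of_mem_cechB ha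
    have h : algebraMap R (Localization.Away (∏ k, x k)) ((∏ k, x k) ^ N * b) =
        algebraMap R _ ((∏ k, x k) ^ m * w) := by
      rw [map_mul, map_mul, ← hb, ← haw, map_pow, map_pow, mul_left_comm,
        mul_left_comm (_ ^ m) (a (topIndex n)), mul_comm (_ ^ N)]
    obtain ⟨l, hl⟩ := IsLocalization.Away.exists_of_eq (∏ k, x k) h
    refine ⟨l + N, ?_⟩
    rw [pow_add, mul_assoc, hl, ← mul_assoc, ← pow_add, show m + (l + N) = N + (l + m) by omega]
    exact prod_pow_mul_mem_span hw (l + m)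
  · rintro ⟨l, hl⟩
    refine mem_cechB_of_mul_pow_eq hl ?_
    rw [pow_add, ← mul_assoc, hb, map_mul, map_pow, mul_comm]

/-- The exponent in the vanishing criterion can be taken to be a multiple of a given `q`. -/
theorem exists_mem_span_mul_of_mem_cechB {q : ℕ} (hq : 0 < q) {a : CechCochain x n} {b : R} {m : ℕ}
    (hb : a (topIndex n) * algebraMap R _ (∏ k, x k) ^ (q * m) = algebraMap R _ b)
    (ha : a ∈ cechB x n) :
    ∃ l, (∏ k, x k) ^ (q * l) * b ∈ Ideal.span (Set.range fun i => x i ^ (q * (m + l))) := by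
  obtain ⟨l, hl⟩ := (mem_cechB_top_iff hb).1 ha
  refine ⟨l, ?_⟩
  -- The exponent `l` becomes `q * l` after multiplication by `(∏ x) ^ (q * l - l)`.
  have hlq : q * l - l + l = q * l := Nat.sub_add_cancel (Nat.le_mul_of_pos_left l hq)
  have h := prod_pow_mul_mem_span hl (q * l - l)
  rwa [← mul_assoc, ← pow_add, hlq, show q * m + l + (q * l - l) = q * (m + l) by
    rw [mul_add]; omega] at h

/-- If `I S ∩ R = I` for all ideals `I` of `R`, as happens when `S` is faithfully flat, then `R → S`
induces an injection on top local cohomology. -/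
theorem mem_cechB_of_cochainMap_mem {S : Type*} [CommRing S] {y : Fin n → S} {f : R →+* S}
    (hI : ∀ I : Ideal R, (I.map f).comap f = I) {q : ℕ} (hq : 0 < q)
    (h : ∀ k, f (x k) = y k ^ q) {a : CechCochain x n} (ha : cochainMap f h n a ∈ cechB y n) :
    a ∈ cechB x n := by
  obtain ⟨m, b, hb⟩ := IsLocalization.Away.surj (∏ k, x k) (a (topIndex n))
  refine (mem_cechB_top_iff hb).2 ?_
  have hb' : cochainMap f h n a (topIndex n) * algebraMap S _ (∏ k, y k) ^ (q * m) =
      algebraMap S _ (f b) := by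
    have := congrArg (cechMap f h Finset.univ) hb
    rwa [map_mul, map_pow, cechMap_algebraMap, cechMap_algebraMap, map_prod_eq_pow f h, map_pow,
      ← pow_mul] at this
  obtain ⟨l, hl⟩ := exists_mem_span_mul_of_mem_cechB hq hb' ha
  refine ⟨l, ?_⟩
  rw [← hI (Ideal.span _), Ideal.mem_comap, Ideal.map_span, map_mul, map_pow, map_prod_eq_pow f h,
    ← pow_mul, ← Set.range_comp]
  have hgen : (f ∘ fun i => x i ^ (m + l)) = fun i => y i ^ (q * (m + l)) :=
    funext fun i => by rw [Function.comp_apply, map_pow, h, pow_mul]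
  rwa [hgen]

end TopDegree

/-! ### Tight closure of zero in top local cohomology -/

section TightClosure

variable {R : Type*} [CommRing R] (p : ℕ) [Fact p.Prime] [CharP R p] {n : ℕ} (x : Fin n → R)

theorem smul_frobeniusPushforwardOf (e : ℕ) (r c : R) :
    r • frobeniusPushforwardOf R p e c = frobeniusPushforwardOf R p e (r ^ p ^ e * c) := by
  rw [← iterateFrobenius_def]
  rfl

/-- The natural map `H^i ⊗ F^e_* R → H^i`, `η ⊗ F^e_* c ↦ c F^e(η)`. -/
noncomputable def frobeniusTensorMap (e i : ℕ) :
    CechCohomology x i ⊗[R] FrobeniusPushforward R p e →+ CechCohomology x i :=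
  TensorProduct.liftAddHom
    (AddMonoidHom.mk' (fun η => AddMonoidHom.mk'
      (fun c : FrobeniusPushforward R p e => (show R from c) • frobeniusAction p x e i η)
      fun c c' => add_smul (show R from c) (show R from c') _)
      fun η η' => AddMonoidHom.ext fun c => by
        change (show R from c) • frobeniusAction p x e i (η + η') = _
        rw [map_add, smul_add]
        rfl)
    fun r η c => by
      change (show R from c) • frobeniusAction p x e i (r • η) =
        (iterateFrobenius R p e r * (show R from c)) • frobeniusAction p x e i η
      rw [LinearMap.map_smulₛₗ, smul_smul, mul_comm]

theorem frobeniusTensorMap_tmul (e i : ℕ) (η : CechCohomology x i) (c : R) :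
    frobeniusTensorMap p x e i (η ⊗ₜ frobeniusPushforwardOf R p e c) =
      c • frobeniusAction p x e i η :=
  rfl

theorem smul_cechFrob_mem_of_tmul_eq_zero {e i : ℕ} {a : CechCochain x i} (ha : cechD x i a = 0)
    {c : R} (h : cechClass x a ha ⊗ₜ[R] frobeniusPushforwardOf R p e c = 0) :
    c • cechFrob p x e i a ∈ cechB x i := by
  have h1 := frobeniusTensorMap_tmul p x e i (cechClass x a ha) c
  rw [h, map_zero, frobeniusAction_cechClass] at h1
  exact (cechClass_eq_zero_iff x (a := c • cechFrob p x e i a) (by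
    rw [map_smul, cechD_cechFrob_eq_zero p x e ha, smul_zero])).1 h1.symm

/-- In top degree a pure tensor `η ⊗ F^e_* c` vanishes as soon as `c F^e(η)` does: for `u` the class of
`1 / (x_1 ⋯ x_n) ^ N`, the tensor `u ⊗ F^e_* w` vanishes for `w` in the ideal of the
`x_i ^ (p ^ e * N)`, because `x_i ^ N u = 0`. -/
theorem tmul_eq_zero_of_smul_cechFrob_mem {e : ℕ} {a : CechCochain x n} {c : R}
    (h : c • cechFrob p x e n a ∈ cechB x n) :
    cechClass x a (cechD_top a) ⊗ₜ[R] frobeniusPushforwardOf R p e c = 0 := by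
  obtain ⟨m, b, hb⟩ := IsLocalization.Away.surj (∏ k, x k) (a (topIndex n))
  have hb' : (c • cechFrob p x e n a) (topIndex n) * algebraMap R _ (∏ k, x k) ^ (p ^ e * m) =
      algebraMap R _ (c * b ^ p ^ e) := by
    rw [Pi.smul_apply, cechFrob_apply, smul_mul_assoc, mul_comm (p ^ e), pow_mul, ← mul_pow, hb,
      Algebra.smul_def, map_mul, map_pow]
  obtain ⟨l, hl⟩ :=
    exists_mem_span_mul_of_mem_cechB (pow_pos (Fact.out : p.Prime).pos e) hb' h
  obtain ⟨u, hu⟩ := exists_cochain_mul_pow_eq x n (m + l) 1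
  have hau : a = ((∏ k, x k) ^ l * b) • u := by
    refine cochain_top_eq_of_mul_pow_eq (N := m + l) ?_
    rw [Pi.smul_apply, smul_mul_assoc, hu, map_one, pow_add, ← mul_assoc, hb, Algebra.smul_def,
      mul_one, map_mul, map_pow, mul_comm]
  have hcl : cechClass x a (cechD_top a) =
      ((∏ k, x k) ^ l * b) • cechClass x u (cechD_top u) := by
    subst hau
    rfl
  have key : ∀ w ∈ Ideal.span (Set.range fun i => x i ^ (p ^ e * (m + l))),
      cechClass x u (cechD_top u) ⊗ₜ[R] frobeniusPushforwardOf R p e w = 0 := by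
    intro w hw
    obtain ⟨r, rfl⟩ := Ideal.mem_span_range_iff_exists_fun.1 hw
    have hsum : frobeniusPushforwardOf R p e (∑ i, r i * x i ^ (p ^ e * (m + l))) =
        ∑ i, x i ^ (m + l) • frobeniusPushforwardOf R p e (r i) := by
      simp_rw [smul_frobeniusPushforwardOf, ← pow_mul, mul_comm (m + l), mul_comm (r _)]
      rfl
    rw [hsum, TensorProduct.tmul_sum]
    refine Finset.sum_eq_zero fun i _ => ?_
    rw [← TensorProduct.smul_tmul]
    have hz : x i ^ (m + l) • cechClass x u (cechD_top u) = 0 :=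
      (cechClass_eq_zero_iff x (a := x i ^ (m + l) • u) (cechD_top _)).2
        (mem_cechB_of_mul_pow_eq_pow (i := i) (N := m + l) (by
          rw [Pi.smul_apply, smul_mul_assoc, hu, Algebra.smul_def, map_one, mul_one]))
    rw [hz, TensorProduct.zero_tmul]
  rw [hcl, TensorProduct.smul_tmul, smul_frobeniusPushforwardOf]
  refine key _ ?_
  rwa [mul_pow, ← pow_mul, mul_comm l, mul_assoc, mul_comm (b ^ _)]

theorem cechClass_mem_tightClosureZero_iff {a : CechCochain x n} :
    cechClass x a (cechD_top a) ∈ tightClosureZero R p (CechCohomology x n) ↔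
      ∃ c : R, (∀ P ∈ minimalPrimes R, c ∉ P) ∧
        ∃ e₀ : ℕ, ∀ e ≥ e₀, c • cechFrob p x e n a ∈ cechB x n := by
  refine exists_congr fun c => and_congr_right fun _ => exists_congr fun e₀ =>
    forall₂_congr fun e _ => ⟨smul_cechFrob_mem_of_tmul_eq_zero p x (cechD_top a),
      tmul_eq_zero_of_smul_cechFrob_mem p x⟩

theorem frobeniusClosureZero_subset_tightClosureZero :
    frobeniusClosureZero p x n ⊆ tightClosureZero R p (CechCohomology x n) := by
  intro η hη
  obtain ⟨a, ha, rfl⟩ := exists_cechClass_eq x η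
  obtain ⟨e₀, he₀⟩ := hη
  refine (cechClass_mem_tightClosureZero_iff p x).2
    ⟨1, fun P hP h => hP.1.1.ne_top ((Ideal.eq_top_iff_one P).2 h), e₀, fun e he => ?_⟩
  rw [one_smul]
  exact (cechClass_eq_zero_iff x _).1 (he₀ e he)

end TightClosure

/-! ### `F`-nilpotence along a faithfully flat `p`-radical homomorphism -/

section Descent

variable {R S : Type*} [CommRing R] [CommRing S] {p : ℕ} [Fact p.Prime] {f : R →+* S}

/-- Some Frobenius power of an element of `S` outside all minimal primes comes from an element of
`R` outside all minimal primes. -/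
theorem exists_map_eq_pow_notMem_minimalPrimes (hf : IsPRadical f p) {c : S}
    (hc : ∀ Q ∈ minimalPrimes S, c ∉ Q) :
    ∃ (e : ℕ) (c' : R), f c' = c ^ p ^ e ∧ ∀ P ∈ minimalPrimes R, c' ∉ P := by
  obtain ⟨e, c', hc'⟩ := hf.pow_mem' c
  refine ⟨e, c', hc', fun P hP hcP => ?_⟩
  have hPp : P.IsPrime := hP.1.1
  obtain ⟨Q, hQ⟩ := (isHomeomorph_comap hf).surjective ⟨P, hPp⟩
  have hQP : Q.asIdeal.comap f = P := congrArg PrimeSpectrum.asIdeal hQ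
  have := Q.2
  obtain ⟨Q', hQ', hle⟩ :=
    Ideal.exists_minimalPrimes_le (I := (⊥ : Ideal S)) (J := Q.asIdeal) bot_le
  have hQ'p : Q'.IsPrime := hQ'.1.1
  have hPQ' : P ≤ Q'.comap f :=
    hP.2 ⟨Ideal.IsPrime.comap f, bot_le⟩ ((Ideal.comap_mono hle).trans hQP.le)
  refine hc Q' hQ' (hQ'p.mem_of_pow_mem (p ^ e) ?_)
  rw [← hc']
  exact hPQ' hcP

variable [CharP R p] [CharP S p]

/-- Faithful flatness enters only through `I S ∩ R = I`: a class of `R` whose image is killed by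
`c' F ^ e` is itself killed by `c' F ^ e`. -/
theorem isFNilpotent_of_isPRadical [IsLocalRing R] [IsLocalRing S] [IsLocalHom f]
    (hf : IsPRadical f p) (hI : ∀ I : Ideal R, (I.map f).comap f = I) (hR : IsFNilpotent R p) :
    IsFNilpotent S p := by
  refine ⟨isWeaklyFNilpotent_of_isPRadical hf hR.1, fun d y hy => Set.Subset.antisymm ?_
    (frobeniusClosureZero_subset_tightClosureZero p y)⟩
  intro η hη
  obtain ⟨r, x, h, hx⟩ := exists_isSystemOfParameters hf hy
  obtain ⟨a, ha, rfl⟩ := exists_cechClass_eq y η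
  obtain ⟨e₁, b, hb, hba⟩ := exists_cocycle_cochainMap_eq hf h ha
  obtain ⟨c, hc, e₀, he₀⟩ := (cechClass_mem_tightClosureZero_iff p y).1 hη
  obtain ⟨e₂, c', hc', hcR⟩ := exists_map_eq_pow_notMem_minimalPrimes hf hc
  have hbt : cechClass x b hb ∈ tightClosureZero R p (CechCohomology x d) := by
    refine (cechClass_mem_tightClosureZero_iff p x).2 ⟨c', hcR, e₀ + e₂, fun e he => ?_⟩
    refine mem_cechB_of_cochainMap_mem hI (pow_pos (Fact.out : p.Prime).pos r) h ?_
    -- Applying `F ^ e₂` to the relation `c F ^ (e - e₂ + e₁)(η) = 0` turns `c` into `f c'`.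
    have h1 := cechFrob_mem_cechB p y e₂ (he₀ (e - e₂ + e₁) (by omega))
    rwa [LinearMap.map_smulₛₗ, iterateFrobenius_def, ← hc', ← cechFrob_cechFrob, ← hba,
      cechFrob_cechFrob, Nat.add_sub_cancel' (by omega : e₂ ≤ e), ← cochainMap_cechFrob,
      ← cochainMap_smul] at h1
  rw [hR.2 d x hx] at hbt
  obtain ⟨e', he'⟩ := (cechClass_mem_frobeniusClosureZero_iff p x hb).1 hbt
  refine (cechClass_mem_frobeniusClosureZero_iff p y ha).2 ⟨e' + e₁, ?_⟩
  rw [← cechFrob_cechFrob, ← hba, ← cochainMap_cechFrob]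
  exact cochainMap_mem_cechB f h he'

end Descent

end FNil

theorem mainTheorem3 (p : ℕ) [Fact p.Prime]
    (R S : Type*) [CommRing R] [CommRing S] [IsLocalRing R] [IsLocalRing S]
    [IsNoetherianRing R] [IsNoetherianRing S] [CharP R p] [CharP S p]
    [Algebra R S] [IsLocalHom (algebraMap R S)] (hRS : IsPRadical (algebraMap R S) p) :
    (FNil.IsWeaklyFNilpotent R p → FNil.IsWeaklyFNilpotent S p) ∧
      (Module.FaithfullyFlat R S → FNil.IsFNilpotent R p → FNil.IsFNilpotent S p) :=
  ⟨FNil.isWeaklyFNilpotent_of_isPRadical hRS, fun _ =>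
    FNil.isFNilpotent_of_isPRadical hRS fun I =>
      Ideal.comap_map_eq_self_of_faithfullyFlat I⟩
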